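/- For a partition $\lambda$ of $n$ let $\chi_\lambda$ be the irreducible complex character of the symmetric group $\mathfrak S_n$ indexed by $\lambda$ (the character of the Specht module $S^\lambda$), and for $0\le j\le\lfloor n/2\rfloor$ let $\chi_\lambda(j)$ be its value at a permutation of cycle type $2^j1^{n-2j}$. For $0\le k\le\lfloor n/2\rfloor$ and $0\le i\le\lfloor n/2\rfloor$ define $\alpha_{n,k,i}$ by $$2^i\,\alpha_{n,k,i}=\sum_{j=0}^{i}\binom ij\,\chi_{(n-k,k)}(j),$$ where $(n-k,k)$ is the partition of $n$ with at most two rows. For $0\le i\le\lfloor n/2\rfloor$ let $$p_{n,i}(x)=(1+x)^{n-2i}(1+x+x^2)^i=\sum_{k}p_{n,i,k}\,x^k,$$ with $p_{n,i,k}=0$ for $k<0$ and for $k>n$. **Lemma.** Let $n=2\ell+s$ with $s\in\{0,1\}$, and let $1\le i\le \ell$. Then: 1. for every integer $k$, $\;p_{n,i,k}=p_{n-2,i-1,k}+p_{n-2,i-1,k-1}+p_{n-2,i-1,k-2}$; 2. for every integer $k$ with $0\le k\le \ell$, $\;\alpha_{n,k,i}=p_{n,i,k}-p_{n,i,k-1}$.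 -/

import Mathlib

noncomputable section

namespace TwoRow

open Equiv

/-! ### Specht modules and irreducible characters of the symmetric group -/

/-- The permutation representation of `𝔖ₙ` on the free `ℂ`-vector space on all maps
`r : Fin n → ℕ`, where `σ` sends the basis vector `r` to `r ∘ σ⁻¹`.
A tabloid (a tableau up to reordering its rows) is encoded by the map `r` that sends an entry to
the index of its row, so this representation is the direct sum of the
tabloid modules `M^c` over all compositions `c` of `n`. -/
def tabloidRep (n : ℕ) : Representation ℂ (Perm (Fin n)) ((Fin n → ℕ) →₀ ℂ) where
  toFun σ := Finsupp.lmapDomain ℂ ℂ (fun r : Fin n → ℕ => r ∘ ⇑σ⁻¹)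
  map_one' := by
    ext r
    simp
  map_mul' σ τ := by
    ext r : 2
    simp [Finsupp.mapDomain_single, Function.comp_def]

theorem tabloidRep_single {n : ℕ} (σ : Perm (Fin n)) (r : Fin n → ℕ) (c : ℂ) :
    tabloidRep n σ (Finsupp.single r c) = Finsupp.single (r ∘ ⇑σ⁻¹) c := by
  simp [tabloidRep, Finsupp.mapDomain_single]

/-- A Young tableau of shape `μ` with entries `Fin n`, each used once: `t x` is the cell
(row, column) which contains the entry `x`. -/
abbrev Tableau (n : ℕ) (μ : YoungDiagram) : Type := Fin n ≃ μ.cells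

/-- The row in which each entry of `t` lies: the tabloid of `t`. -/
def Tableau.row {n : ℕ} {μ : YoungDiagram} (t : Tableau n μ) (x : Fin n) : ℕ := (t x).1.1

/-- The column in which each entry of `t` lies. -/
def Tableau.col {n : ℕ} {μ : YoungDiagram} (t : Tableau n μ) (x : Fin n) : ℕ := (t x).1.2

/-- The column stabilizer of `t`: the permutations that preserve every column of `t`. -/
def Tableau.colStab {n : ℕ} {μ : YoungDiagram} (t : Tableau n μ) : Finset (Perm (Fin n)) :=
  Finset.univ.filter fun σ => ∀ x, t.col (σ x) = t.col x

theorem Tableau.mem_colStab {n : ℕ} {μ : YoungDiagram} (t : Tableau n μ) (σ : Perm (Fin n)) :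
    σ ∈ t.colStab ↔ ∀ x, t.col (σ x) = t.col x := by
  simp [Tableau.colStab]

/-- The polytabloid `e_t = ∑_{σ ∈ C_t} sgn(σ) σ·{t}`. -/
def Tableau.polytabloid {n : ℕ} {μ : YoungDiagram} (t : Tableau n μ) : (Fin n → ℕ) →₀ ℂ :=
  ∑ σ ∈ t.colStab, ((Perm.sign σ : ℤ) : ℂ) • tabloidRep n σ (Finsupp.single t.row 1)

/-- `𝔖ₙ` permutes the polytabloids: `σ · e_t = e_{σt}`. -/
theorem tabloidRep_polytabloid {n : ℕ} {μ : YoungDiagram} (t : Tableau n μ)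
    (σ : Perm (Fin n)) :
    tabloidRep n σ t.polytabloid = Tableau.polytabloid (σ⁻¹.trans t : Tableau n μ) := by
  unfold Tableau.polytabloid
  rw [map_sum]
  refine Finset.sum_bij' (fun τ _ => σ * τ * σ⁻¹) (fun τ _ => σ⁻¹ * τ * σ) ?_ ?_ ?_ ?_ ?_
  · intro τ hτ
    rw [Tableau.mem_colStab] at hτ ⊢
    intro x
    simpa [Tableau.col] using hτ (σ⁻¹ x)
  · intro τ hτ
    rw [Tableau.mem_colStab] at hτ ⊢
    intro x
    simpa [Tableau.col] using hτ (σ x)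
  · intro τ _
    group
  · intro τ _
    group
  · intro τ _
    have hs : Perm.sign (σ * τ * σ⁻¹) = Perm.sign τ := by
      rw [map_mul, map_mul, Perm.sign_inv, mul_right_comm, Int.units_mul_self, one_mul]
    rw [hs, map_smul, tabloidRep_single, tabloidRep_single, tabloidRep_single]
    congr 2
    ext x
    simp [Tableau.row]

/-- The Specht module `S^μ`: the span of the polytabloids of all tableaux of shape `μ`, as a
subrepresentation of the tabloid representation. -/
def specht (n : ℕ) (μ : YoungDiagram) : Subrepresentation (tabloidRep n) where
  toSubmodule := Submodule.span ℂ (Set.range fun t : Tableau n μ => t.polytabloid)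
  apply_mem_toSubmodule σ v hv := by
    induction hv using Submodule.span_induction with
    | mem x hx =>
      obtain ⟨t, rfl⟩ := hx
      rw [tabloidRep_polytabloid]
      exact Submodule.subset_span ⟨_, rfl⟩
    | zero => simp
    | add x y _ _ hx hy => rw [map_add]; exact Submodule.add_mem _ hx hy
    | smul c x _ hx => rw [map_smul]; exact Submodule.smul_mem _ c hx

/-- The irreducible complex character `χ_μ` of `𝔖ₙ` indexed by a partition `μ` of `n`
(given by its Young diagram): the trace of `σ` on the Specht module `S^μ`. -/
def chi (n : ℕ) (μ : YoungDiagram) (σ : Perm (Fin n)) : ℂ :=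
  LinearMap.trace ℂ (specht n μ).toSubmodule ((specht n μ).toRepresentation σ)

/-- For `2j ≤ n` there is a permutation in `𝔖ₙ` of cycle type `2^j 1^{n-2j}`
(`Equiv.Perm.cycleType` does not list fixed points). -/
theorem exists_involution (n j : ℕ) (h : 2 * j ≤ n) :
    ∃ σ : Perm (Fin n), σ.cycleType = Multiset.replicate j 2 := by
  rw [Equiv.Perm.exists_with_cycleType_iff]
  refine ⟨by simpa [mul_comm] using h, fun a ha => ?_⟩
  rw [Multiset.eq_of_mem_replicate ha]

/-- `χ_μ(j)`: the value of `χ_μ` at a permutation of cycle type `2^j 1^{n-2j}`, for `2j ≤ n`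
(and `0` otherwise). -/
def chiAt (n : ℕ) (μ : YoungDiagram) (j : ℕ) : ℂ :=
  if h : 2 * j ≤ n then chi n μ (exists_involution n j h).choose else 0

/-- The value `χ_μ(j)` does not depend on the chosen permutation of cycle type `2^j 1^{n-2j}`. -/
theorem chiAt_eq {n : ℕ} (μ : YoungDiagram) {j : ℕ} (h : 2 * j ≤ n) (σ : Perm (Fin n))
    (hσ : σ.cycleType = Multiset.replicate j 2) : chiAt n μ j = chi n μ σ := by
  rw [chiAt, dif_pos h]
  have hc : IsConj σ (exists_involution n j h).choose := by
    rw [Equiv.Perm.isConj_iff_cycleType_eq, hσ, (exists_involution n j h).choose_spec]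
  obtain ⟨g, hg⟩ := isConj_iff.mp hc
  rw [← hg]
  rw [chi, chi, map_mul, LinearMap.trace_mul_comm, ← map_mul, inv_mul_cancel_left]

/-! ### The numbers `α` -/

/-- `α_{n,μ,i}`, defined by `2^i α_{n,μ,i} = ∑_{j=0}^{i} binom(i,j) χ_μ(j)`, for `2i ≤ n`. -/
def alphaShape (n : ℕ) (μ : YoungDiagram) (i : ℕ) : ℂ :=
  (∑ j ∈ Finset.range (i + 1), (i.choose j : ℂ) * chiAt n μ j) / 2 ^ i

/-- The two-row partition `(n-k, k)` of `n`, for `0 ≤ k ≤ ⌊n/2⌋`. -/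
def twoRow (n k : ℕ) (h : 2 * k ≤ n) : YoungDiagram :=
  YoungDiagram.ofRowLens [n - k, k] (by
    simp only [List.sortedGE_iff_pairwise]
    simp
    omega)

/-- `α_{n,k,i}`, the number `α_{n,μ,i}` for the two-row partition `μ = (n-k, k)`; by convention
it is `0` if `k > ⌊n/2⌋` or `i > ⌊n/2⌋`. -/
def alpha (n k i : ℕ) : ℂ :=
  if h : 2 * k ≤ n ∧ 2 * i ≤ n then alphaShape n (twoRow n k h.1) i else 0

/-! ### The polynomials `p_{n,i}(x)` -/

/-- The polynomial `p_{n,i}(x) = (1+x)^{n-2i} (1+x+x²)^i`, for `2i ≤ n`. -/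
def pPoly (n i : ℕ) : Polynomial ℤ :=
  (1 + Polynomial.X) ^ (n - 2 * i) * (1 + Polynomial.X + Polynomial.X ^ 2) ^ i

/-- `p_{n,i,k}`, the coefficient of `x^k` in `p_{n,i}(x)`; it is `0` for `k < 0`. -/
def p (n i : ℕ) (k : ℤ) : ℤ :=
  if 0 ≤ k then (pPoly n i).coeff k.toNat else 0

end TwoRow

end

/-!
A function on the `k`-subsets of `Fin n` is a multilinear form of degree `k` in `n` variables, and
a two-row polytabloid is the form `∏ⱼ (x_{bⱼ} - x_{aⱼ})`, with one factor for each column `{aⱼ, bⱼ}`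
of length two (`polytabloid_eq_toTabloid`; the signed sum over the column stabilizer is a
determinant which is block diagonal along the columns). Such a form is killed by `D = ∑ₓ ∂ₓ`, the
operator `lower`, and the key point is that for `2k ≤ n` the Specht module `S^(n-k,k)` is the whole
kernel of `D` in degree `k` (`specht_twoRow`, from `slice_inf_ker_lower`). This is shown by
induction on the number of variables: writing `f = x g + h`, the form `g` is killed by `D`, hence a
combination of products of `k - 1` differences, and multiplying each of them by `x - x_c` with an
unused `x_c` gives an element of the span that differs from `f` by a form without `x`.

The commutation relation `D U - U D = n - 2k` between `D` and its adjoint `U` (`lower_raise`) shows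
that `D` is injective in degrees above `n / 2` (needed in the induction) and maps degree `k` onto
degree `k - 1` if `2k ≤ n`. As `D` commutes with permutations, the trace on its kernel is a
difference of two permutation characters: `χ_(n-k,k)(σ)` is the number of `k`-subsets fixed by `σ`
minus the number of fixed `(k-1)`-subsets (`chi_twoRow`).

The subsets fixed by a permutation of cycle type `2^j 1^(n-2j)` have the generating function
`(1 + x)^(n-2j) (1 + x²)^j`, and `(1 + x)² + (1 + x²) = 2 (1 + x + x²)` turns the binomial sum over
`j` into `2^i p_{n,i}` (`sum_choose_mul_invPoly`). The recurrence is the factorization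
`p_{n,i} = (1 + x + x²) p_{n-2,i-1}`.
-/

set_option linter.unusedSectionVars false

/-! ### Lowering and raising operators on functions on finite sets -/

namespace TwoRow

open Finset

section Slices

variable {α : Type*} [DecidableEq α]

/-- The lowering operator on functions on finite sets, relative to a ground set `S`:
`(D f)(B)` is the sum of `f` over the sets obtained from `B` by adding one point of `S`. -/
def lower (S : Finset α) : (Finset α → ℂ) →ₗ[ℂ] (Finset α → ℂ) where
  toFun f B := ∑ a ∈ S \ B, f (insert a B)
  map_add' f g := by ext B; simp [sum_add_distrib]
  map_smul' c f := by ext B; simp [mul_sum]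

/-- The raising operator, adjoint to `lower S`: `(U f)(A)` is the sum of `f` over the sets
obtained from `A` by removing one point of `S`. -/
def raise (S : Finset α) : (Finset α → ℂ) →ₗ[ℂ] (Finset α → ℂ) where
  toFun f A := ∑ a ∈ S ∩ A, f (A.erase a)
  map_add' f g := by ext B; simp [sum_add_distrib]
  map_smul' c f := by ext B; simp [mul_sum]

theorem lower_apply (S : Finset α) (f : Finset α → ℂ) (B : Finset α) :
    lower S f B = ∑ a ∈ S \ B, f (insert a B) := rfl

theorem raise_apply (S : Finset α) (f : Finset α → ℂ) (A : Finset α) :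
    raise S f A = ∑ a ∈ S ∩ A, f (A.erase a) := rfl

/-- The functions supported on the subsets `A` of `S` with `k` elements, where `A` is counted as
having `#A + d` elements. The shift `d` makes `slice S 1 k` the space of functions on the
`(k - 1)`-subsets without truncated subtraction: it is zero for `k = 0`. -/
def slice (S : Finset α) (d k : ℕ) : Submodule ℂ (Finset α → ℂ) where
  carrier := {f | ∀ A, ¬(A ⊆ S ∧ #A + d = k) → f A = 0}
  add_mem' hf hg A hA := by simp [hf A hA, hg A hA]
  zero_mem' A _ := rfl
  smul_mem' c f hf A hA := by simp [hf A hA]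

theorem lower_mem_slice {S : Finset α} {k : ℕ} {f : Finset α → ℂ} (hf : f ∈ slice S 0 k) :
    lower S f ∈ slice S 1 k := by
  intro B hB
  refine sum_eq_zero fun a ha => hf _ fun h => hB ?_
  rw [mem_sdiff] at ha
  rw [card_insert_of_notMem ha.2, add_zero] at h
  exact ⟨(subset_insert _ _).trans h.1, h.2⟩

theorem raise_mem_slice {S : Finset α} {k : ℕ} {f : Finset α → ℂ} (hf : f ∈ slice S 1 k) :
    raise S f ∈ slice S 0 k := by
  intro A hA
  refine sum_eq_zero fun a ha => hf _ fun h => hA ?_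
  rw [mem_inter] at ha
  rw [card_erase_add_one ha.2] at h
  refine ⟨?_, h.2⟩
  rw [← insert_erase ha.2]
  exact insert_subset ha.1 h.1

/-- The `sl₂` commutation relation between the lowering and the raising operator. -/
theorem lower_raise (S : Finset α) (f : Finset α → ℂ) (B : Finset α) :
    lower S (raise S f) B + #(S ∩ B) * f B = raise S (lower S f) B + #(S \ B) * f B := by
  have h1 : lower S (raise S f) B =
      ∑ a ∈ S \ B, (f B + ∑ c ∈ S ∩ B, f (insert a (B.erase c))) := by
    refine sum_congr rfl fun a ha => ?_
    rw [mem_sdiff] at ha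
    rw [raise_apply, inter_insert_of_mem ha.1, sum_insert (by simp [ha.2]),
      erase_insert ha.2]
    congr 1
    refine sum_congr rfl fun c hc => ?_
    rw [erase_insert_of_ne]
    rintro rfl
    exact ha.2 (mem_inter.1 hc).2
  have h2 : raise S (lower S f) B =
      ∑ c ∈ S ∩ B, (f B + ∑ a ∈ S \ B, f (insert a (B.erase c))) := by
    refine sum_congr rfl fun c hc => ?_
    rw [mem_inter] at hc
    rw [lower_apply, sdiff_erase hc.1, sum_insert (by simp [hc.2]), insert_erase hc.2]
  rw [h1, h2, sum_add_distrib, sum_add_distrib, sum_comm]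
  simp only [sum_const, nsmul_eq_mul]
  ring

variable [Fintype α]

theorem sum_mul_raise (S : Finset α) (f g : Finset α → ℂ) :
    ∑ A, f A * raise S g A = ∑ B, lower S f B * g B := by
  simp only [raise_apply, lower_apply, mul_sum, sum_mul]
  rw [sum_sigma', sum_sigma']
  refine sum_bij' (fun x _ => ⟨x.1.erase x.2, x.2⟩) (fun y _ => ⟨insert y.2 y.1, y.2⟩)
    ?_ ?_ ?_ ?_ ?_
  · rintro ⟨A, a⟩ h
    simp_all
  · rintro ⟨A, a⟩ h
    simp_all
  · rintro ⟨A, a⟩ h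
    simp_all
  · rintro ⟨A, a⟩ h
    simp_all
  · rintro ⟨A, a⟩ h
    simp_all

/-- The squared `ℓ²` norm of a function on the subsets of `α`. -/
def energy (f : Finset α → ℂ) : ℝ := ∑ A, Complex.normSq (f A)

theorem energy_nonneg (f : Finset α → ℂ) : 0 ≤ energy f :=
  sum_nonneg fun _ _ => Complex.normSq_nonneg _

theorem eq_zero_of_energy_nonpos {f : Finset α → ℂ} (h : energy f ≤ 0) : f = 0 := by
  have h0 := (sum_eq_zero_iff_of_nonneg fun A _ => Complex.normSq_nonneg (f A)).1
    (le_antisymm h (energy_nonneg f))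
  ext A
  simpa using h0 A (mem_univ A)

theorem ofReal_energy (f : Finset α → ℂ) : (energy f : ℂ) = ∑ A, star (f) A * f A := by
  simp [energy, Complex.normSq_eq_conj_mul_self]

/-- The commutation relation paired with `f`. For `d = 0` it reads
`‖U f‖² = ‖D f‖² + (#S - 2k) ‖f‖²`. -/
theorem energy_raise {S : Finset α} {d k : ℕ} {f : Finset α → ℂ} (hf : f ∈ slice S d k) :
    energy (raise S f) + 2 * k * energy f = energy (lower S f) + (#S + 2 * d) * energy f := by
  have hl : ∀ g, lower S (star g) = star (lower S g) := fun g => by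
    ext B; simp [lower_apply]
  have hr : ∀ g, raise S (star g) = star (raise S g) := fun g => by
    ext B; simp [raise_apply]
  have h1 : (energy (raise S f) : ℂ) = ∑ B, star f B * lower S (raise S f) B := by
    rw [ofReal_energy]
    calc ∑ A, star (raise S f) A * raise S f A = ∑ A, raise S f A * raise S (star f) A := by
          simp only [hr, mul_comm]
      _ = _ := by rw [sum_mul_raise]; simp only [mul_comm]
  have h2 : (energy (lower S f) : ℂ) = ∑ B, star f B * raise S (lower S f) B := by
    rw [sum_mul_raise, hl, ofReal_energy]
  have h3 : ∀ B, star f B * lower S (raise S f) B + 2 * k * (star f B * f B) =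
      star f B * raise S (lower S f) B + (#S + 2 * d) * (star f B * f B) := by
    intro B
    by_cases hB : B ⊆ S ∧ #B + d = k
    · have h := lower_raise S f B
      have hc : (#(S \ B) : ℂ) + #B = #S := by
        exact_mod_cast card_sdiff_add_card_eq_card hB.1
      have hk : (#B : ℂ) + d = k := by exact_mod_cast hB.2
      rw [inter_eq_right.2 hB.1] at h
      linear_combination star f B * h + star f B * f B * hc - 2 * star f B * f B * hk
    · simp [hf B hB]
  have h4 := sum_congr (rfl : (univ : Finset (Finset α)) = univ) fun B _ => h3 B
  simp only [sum_add_distrib, ← mul_sum, ← h1, ← h2, ← ofReal_energy] at h4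
  exact_mod_cast h4

/-- The lowering operator is injective above the middle. -/
theorem eq_zero_of_lower_eq_zero {S : Finset α} {k : ℕ} {f : Finset α → ℂ}
    (hf : f ∈ slice S 0 k) (hk : #S < 2 * k) (h : lower S f = 0) : f = 0 := by
  have h1 := energy_raise hf
  have h2 : energy (lower S f) = 0 := by simp [h, energy]
  have h3 : (#S : ℝ) + 1 ≤ 2 * k := by exact_mod_cast hk
  have h4 := energy_nonneg (raise S f)
  have h5 := energy_nonneg f
  apply eq_zero_of_energy_nonpos
  push_cast at h1
  nlinarith

/-- The lowering operator is onto below the middle: `lower S ∘ raise S` is positive definite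
on `slice S 1 k`, hence bijective there. -/
theorem exists_lower_eq {S : Finset α} {k : ℕ} (hk : 2 * k ≤ #S) {g : Finset α → ℂ}
    (hg : g ∈ slice S 1 k) : ∃ f ∈ slice S 0 k, lower S f = g := by
  let T : slice S 1 k →ₗ[ℂ] slice S 1 k :=
    (lower S ∘ₗ raise S).restrict fun f hf => lower_mem_slice (raise_mem_slice hf)
  have hT : Function.Injective T := by
    rw [← LinearMap.ker_eq_bot, LinearMap.ker_eq_bot']
    rintro ⟨f, hf⟩ h
    have h0 : lower S (raise S f) = 0 := congrArg Subtype.val h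
    have h1 : energy (raise S f) = 0 := by
      have : (energy (raise S f) : ℂ) = 0 := by
        rw [ofReal_energy, sum_mul_raise]
        have hl : lower S (star (raise S f)) = star (lower S (raise S f)) := by
          ext B; simp [lower_apply]
        simp [hl, h0]
      exact_mod_cast this
    have h2 := energy_raise hf
    have h3 := energy_nonneg (lower S f)
    have h4 := energy_nonneg f
    have h5 : 2 * (k : ℝ) ≤ #S := by exact_mod_cast hk
    ext1
    apply eq_zero_of_energy_nonpos
    push_cast at h2
    nlinarith
  obtain ⟨⟨f, hf⟩, h⟩ := LinearMap.surjective_of_injective hT ⟨g, hg⟩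
  exact ⟨raise S f, raise_mem_slice hf, congrArg Subtype.val h⟩

end Slices

end TwoRow

/-! ### Products of disjoint differences span the kernel of the lowering operator -/

namespace TwoRow

open Finset

section PairProducts

variable {α : Type*} [DecidableEq α]

/-- The indicator `1_A(b) - 1_A(a)`: how the pair `(a, b)` splits across `A`. -/
def pairSign (A : Finset α) (a b : α) : ℂ :=
  (if b ∈ A then 1 else 0) - (if a ∈ A then 1 else 0)

/-- The multilinear form `∏ⱼ (x_{bⱼ} - x_{aⱼ})`, as the function that sends a set `A` to the
coefficient of the monomial `∏_{x ∈ A} x`. When the `2k` points are distinct and `#A = k`, the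
product below is nonzero only if `A` contains exactly one point of each pair. -/
def pairProd {k : ℕ} (a b : Fin k → α) (A : Finset α) : ℂ :=
  if #A = k then ∏ j, pairSign A (a j) (b j) else 0

/-- A set that meets `k` disjoint pairs has at least `k` elements. -/
theorem le_card_of_pairs {k : ℕ} {a b : Fin k → α} (h : Function.Injective (Sum.elim a b))
    {A : Finset α} (hA : ∀ j, a j ∈ A ∨ b j ∈ A) : k ≤ #A := by
  have h1 : ∀ j, ∃ x : Fin k ⊕ Fin k, Sum.elim a b x ∈ A ∧ Sum.elim id id x = j := by
    intro j
    rcases hA j with h | h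
    · exact ⟨.inl j, h, rfl⟩
    · exact ⟨.inr j, h, rfl⟩
  choose x hx hj using h1
  have hi : Function.Injective fun j => Sum.elim a b (x j) := fun i j hij => by
    rw [← hj i, ← hj j, h hij]
  simpa using card_le_card_of_injOn (s := univ) _ (fun j _ => hx j) hi.injOn

theorem pairSign_eq_zero {A : Finset α} {a b : α} (ha : a ∉ A) (hb : b ∉ A) :
    pairSign A a b = 0 := by simp [pairSign, ha, hb]

theorem pairSign_insert_of_ne {A : Finset α} {a b c : α} (ha : a ≠ c) (hb : b ≠ c) :
    pairSign (insert c A) a b = pairSign A a b := by simp [pairSign, ha, hb]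

theorem meets_of_prod_ne_zero {k : ℕ} {a b : Fin k → α} {A : Finset α}
    (h : ∏ j, pairSign A (a j) (b j) ≠ 0) (j : Fin k) : a j ∈ A ∨ b j ∈ A := by
  by_contra! hj
  exact h (prod_eq_zero (mem_univ j) (pairSign_eq_zero hj.1 hj.2))

/-- If `#A = k`, a point of `A` outside the `k` pairs leaves some pair disjoint from `A`. -/
theorem prod_eq_zero_of_extra {k : ℕ} {a b : Fin k → α} (h : Function.Injective (Sum.elim a b))
    {A : Finset α} (hA : #A = k) {c : α} (hc : c ∈ A) (hcab : ∀ x, Sum.elim a b x ≠ c) :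
    ∏ j, pairSign A (a j) (b j) = 0 := by
  by_contra h0
  have h1 : k ≤ #(A.erase c) := le_card_of_pairs h fun j => by
    rw [mem_erase, mem_erase]
    exact (meets_of_prod_ne_zero h0 j).imp (fun h => ⟨hcab (.inl j), h⟩)
      fun h => ⟨hcab (.inr j), h⟩
  have := card_erase_add_one hc
  omega

theorem pairProd_mem_slice {S : Finset α} {k : ℕ} {a b : Fin k → α}
    (h : Function.Injective (Sum.elim a b)) (hS : ∀ x, Sum.elim a b x ∈ S) :
    pairProd a b ∈ slice S 0 k := by
  intro A hA
  unfold pairProd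
  split_ifs with hk
  · have : ¬ A ⊆ S := fun h => hA ⟨h, hk⟩
    obtain ⟨c, hc, hcS⟩ := not_subset.1 this
    exact prod_eq_zero_of_extra h hk hc fun x hx => hcS (hx ▸ hS x)
  · rfl

/-- `∑ₓ ∂ₓ` kills a product of differences of variables. -/
theorem lower_pairProd {S : Finset α} {k : ℕ} {a b : Fin k → α}
    (h : Function.Injective (Sum.elim a b)) (hS : ∀ x, Sum.elim a b x ∈ S) :
    lower S (pairProd a b) = 0 := by
  ext B
  rw [lower_apply]
  by_cases hB : #B + 1 = k
  swap
  · refine sum_eq_zero fun c hc => ?_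
    rw [pairProd, if_neg]
    rwa [card_insert_of_notMem (mem_sdiff.1 hc).2]
  -- A pair disjoint from `B` exists by counting; only its two points contribute.
  obtain ⟨j, hj⟩ : ∃ j, a j ∉ B ∧ b j ∉ B := by
    by_contra! h0
    have := le_card_of_pairs (A := B) h fun j => or_iff_not_imp_left.2 (h0 j)
    omega
  have hab : a j ≠ b j := fun e => by simpa using h (a₁ := .inl j) (a₂ := .inr j) e
  have hrest : ∀ c, c = a j ∨ c = b j → ∏ i ∈ univ.erase j, pairSign (insert c B) (a i) (b i) =
      ∏ i ∈ univ.erase j, pairSign B (a i) (b i) := by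
    intro c hc
    refine prod_congr rfl fun i hi => ?_
    have hij := ne_of_mem_erase hi
    apply pairSign_insert_of_ne
    · rintro e
      rcases hc with rfl | rfl
      · exact hij (by simpa using h (a₁ := .inl i) (a₂ := .inl j) e)
      · simpa using h (a₁ := .inl i) (a₂ := .inr j) e
    · rintro e
      rcases hc with rfl | rfl
      · simpa using h (a₁ := .inr i) (a₂ := .inl j) e
      · exact hij (by simpa using h (a₁ := .inr i) (a₂ := .inr j) e)
  rw [← sum_subset (s₁ := {a j, b j})]
  · have hca : #(insert (a j) B) = k := by rw [card_insert_of_notMem hj.1, hB]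
    have hcb : #(insert (b j) B) = k := by rw [card_insert_of_notMem hj.2, hB]
    rw [sum_pair hab, pairProd, pairProd, if_pos hca, if_pos hcb,
      ← mul_prod_erase _ _ (mem_univ j), ← mul_prod_erase _ _ (mem_univ j),
      hrest _ (.inl rfl), hrest _ (.inr rfl)]
    simp [pairSign, hj, hab, hab.symm]
  · have ha := hS (.inl j)
    have hb := hS (.inr j)
    simp only [Sum.elim_inl, Sum.elim_inr] at ha hb
    intro c hc
    rw [mem_insert, mem_singleton] at hc
    rcases hc with rfl | rfl <;> simp [ha, hb, hj]
  · intro c _ hc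
    rw [mem_insert, mem_singleton, not_or] at hc
    rw [pairProd, prod_eq_zero (mem_univ j), ite_self]
    rw [pairSign_insert_of_ne (Ne.symm hc.1) (Ne.symm hc.2), pairSign_eq_zero hj.1 hj.2]

/-- The products of `k` disjoint differences `x_b - x_a` of variables in `S`. -/
def pairProds (S : Finset α) (k : ℕ) : Set (Finset α → ℂ) :=
  {f | ∃ a b : Fin k → α, Function.Injective (Sum.elim a b) ∧ (∀ x, Sum.elim a b x ∈ S) ∧
    f = pairProd a b}

theorem span_pairProds_le (S : Finset α) (k : ℕ) :
    Submodule.span ℂ (pairProds S k) ≤ slice S 0 k ⊓ LinearMap.ker (lower S) := by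
  rw [Submodule.span_le]
  rintro _ ⟨a, b, h, hS, rfl⟩
  exact ⟨pairProd_mem_slice h hS, lower_pairProd h hS⟩

/-- The partial derivative in the variable `x` of a multilinear form. -/
def link (x : α) : (Finset α → ℂ) →ₗ[ℂ] (Finset α → ℂ) where
  toFun f B := if x ∈ B then 0 else f (insert x B)
  map_add' f g := by ext B; by_cases h : x ∈ B <;> simp [h]
  map_smul' c f := by ext B; by_cases h : x ∈ B <;> simp [h]

theorem link_apply (x : α) (f : Finset α → ℂ) (B : Finset α) :
    link x f B = if x ∈ B then 0 else f (insert x B) := rfl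

theorem link_mem_slice {S : Finset α} {x : α} {k : ℕ} {f : Finset α → ℂ}
    (hf : f ∈ slice (insert x S) 0 (k + 1)) : link x f ∈ slice S 0 k := by
  intro B hB
  rw [link_apply]
  split_ifs with hxB
  · rfl
  · refine hf _ fun h => hB ?_
    rw [card_insert_of_notMem hxB] at h
    exact ⟨(insert_subset_insert_iff hxB).1 h.1, by omega⟩

theorem lower_link {S : Finset α} {x : α} (hx : x ∉ S) {f : Finset α → ℂ}
    (hf : lower (insert x S) f = 0) : lower S (link x f) = 0 := by
  ext B
  rw [lower_apply]
  by_cases hxB : x ∈ B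
  · exact sum_eq_zero fun c _ => by simp [link_apply, hxB]
  · have h := congrFun hf (insert x B)
    rw [lower_apply, insert_sdiff_insert,
      sdiff_insert_of_notMem hx] at h
    refine Eq.trans ?_ h
    refine sum_congr rfl fun c hc => ?_
    have hxc : x ≠ c := fun e => hx (e ▸ (mem_sdiff.1 hc).1)
    rw [link_apply, if_neg (by simp [hxc, hxB]), insert_comm]

/-- A form that does not involve the variable `x` lives on the smaller ground set. -/
theorem mem_slice_of_link_eq_zero {S : Finset α} {x : α} {k : ℕ} {f : Finset α → ℂ}
    (hf : f ∈ slice (insert x S) 0 k) (h : link x f = 0) : f ∈ slice S 0 k := by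
  intro A hA
  by_cases hxA : x ∈ A
  · have := congrFun h (A.erase x)
    rwa [link_apply, if_neg (notMem_erase x A), insert_erase hxA] at this
  · exact hf A fun h => hA ⟨(subset_insert_iff_of_notMem hxA).1 h.1, h.2⟩

theorem lower_eq_zero_of_insert {S : Finset α} {x : α} {k : ℕ} {f : Finset α → ℂ}
    (hf : f ∈ slice S 0 k) (h : lower (insert x S) f = 0) : lower S f = 0 := by
  ext B
  have h1 := congrFun h B
  rw [lower_apply] at h1 ⊢
  rw [← h1]
  refine sum_subset (sdiff_subset_sdiff (subset_insert _ _) subset_rfl) fun c hc hc' => hf _ ?_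
  rintro ⟨h2, -⟩
  rw [mem_sdiff] at hc hc'
  exact hc' ⟨h2 (mem_insert_self _ _), hc.2⟩

theorem pairProds_mono {S T : Finset α} (h : S ⊆ T) (k : ℕ) : pairProds S k ⊆ pairProds T k := by
  rintro _ ⟨a, b, hi, hS, rfl⟩
  exact ⟨a, b, hi, fun x => h (hS x), rfl⟩

/-- Multiplying by `x - x_c` for a fresh `c` inverts the partial derivative in `x`. -/
theorem exists_link_eq_pairProd {S : Finset α} {x : α} (hx : x ∉ S) {k : ℕ} (hk : 2 * k < #S)
    {f : Finset α → ℂ} (hf : f ∈ pairProds S k) :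
    ∃ g ∈ pairProds (insert x S) (k + 1), link x g = f := by
  obtain ⟨a, b, h, hS, rfl⟩ := hf
  obtain ⟨c, hcS, hc⟩ : ∃ c ∈ S, c ∉ univ.image (Sum.elim a b) := by
    by_contra! h0
    have h1 := (card_le_card (show S ⊆ univ.image (Sum.elim a b) from h0)).trans card_image_le
    simp at h1
    omega
  have hc' : ∀ y, Sum.elim a b y ≠ c := fun y hy => hc (mem_image.2 ⟨y, mem_univ _, hy⟩)
  have hx' : ∀ y, Sum.elim a b y ≠ x := fun y hy => hx (hy ▸ hS y)
  have hxc : x ≠ c := fun e => hx (e ▸ hcS)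
  refine ⟨pairProd (Fin.cons c a : Fin (k + 1) → α) (Fin.cons x b : Fin (k + 1) → α),
    ⟨_, _, ?_, ?_, rfl⟩, ?_⟩
  · have ha : ∀ i, a i ≠ c := fun i => hc' (.inl i)
    have hb : ∀ i, b i ≠ c := fun i => hc' (.inr i)
    have ha' : ∀ i, a i ≠ x := fun i => hx' (.inl i)
    have hb' : ∀ i, b i ≠ x := fun i => hx' (.inr i)
    rw [Sum.elim_injective] at h ⊢
    refine ⟨Fin.cons_injective_iff.2 ⟨?_, h.1⟩, Fin.cons_injective_iff.2 ⟨?_, h.2.1⟩, ?_⟩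
    · rintro ⟨i, hi⟩
      exact ha i hi
    · rintro ⟨i, hi⟩
      exact hb' i hi
    · intro i j
      refine Fin.cases ?_ (fun i => ?_) i <;> refine Fin.cases ?_ (fun j => ?_) j
      · simpa using hxc.symm
      · simpa using (hb j).symm
      · simpa using ha' i
      · simpa using h.2.2 i j
  · rintro (i | i) <;> refine Fin.cases ?_ (fun i => ?_) i
    · simp [hcS]
    · simpa using Or.inr (hS (.inl i))
    · simp
    · simpa using Or.inr (hS (.inr i))
  · ext B
    rw [link_apply]
    by_cases hk : #B = k
    swap
    · rw [pairProd, pairProd, if_neg hk]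
      split_ifs with h1 h2
      · rfl
      · rw [card_insert_of_notMem h1] at h2
        omega
      · rfl
    rw [pairProd, pairProd, if_pos hk]
    by_cases hxB : x ∈ B
    · rw [if_pos hxB, prod_eq_zero_of_extra h hk hxB hx']
    · rw [if_neg hxB, card_insert_of_notMem hxB, if_pos (by omega), Fin.prod_univ_succ]
      simp only [Fin.cons_zero, Fin.cons_succ]
      have hins : ∀ i, pairSign (insert x B) (a i) (b i) = pairSign B (a i) (b i) := fun i =>
        pairSign_insert_of_ne (hx' (.inl i)) (hx' (.inr i))
      simp only [hins]
      by_cases hcB : c ∈ B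
      · rw [prod_eq_zero_of_extra h hk hcB hc', mul_zero]
      · simp [pairSign, hcB, hxc.symm]

/-- The multilinear forms of degree `k` killed by `∑ₓ ∂ₓ` are spanned by the products of `k`
disjoint differences of variables. -/
theorem slice_inf_ker_lower [Fintype α] (S : Finset α) (k : ℕ) :
    slice S 0 k ⊓ LinearMap.ker (lower S) = Submodule.span ℂ (pairProds S k) := by
  refine le_antisymm ?_ (span_pairProds_le S k)
  induction S using Finset.induction_on generalizing k with
  | empty =>
    rintro f ⟨hf, h0⟩
    replace h0 : lower _ f = 0 := h0
    rcases k.eq_zero_or_pos with rfl | hk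
    · have : f = f ∅ • pairProd (α := α) (k := 0) Fin.elim0 Fin.elim0 := by
        ext A
        by_cases hA : A = ∅
        · simp [hA, pairProd]
        · have := hf A (by simp [hA])
          simp [this, pairProd, hA]
      rw [this]
      refine Submodule.smul_mem _ _ (Submodule.subset_span ⟨_, _, ?_, ?_, rfl⟩)
      · exact Function.injective_of_subsingleton _
      · rintro (i | i) <;> exact i.elim0
    · rw [eq_zero_of_lower_eq_zero hf (by simpa using hk) h0]
      exact zero_mem _
  | insert x S hx ih =>
    rintro f ⟨hf, h0⟩
    replace h0 : lower _ f = 0 := h0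
    by_cases hk : #(insert x S) < 2 * k
    · rw [eq_zero_of_lower_eq_zero hf hk h0]
      exact zero_mem _
    rw [card_insert_of_notMem hx] at hk
    -- It is enough to match the part of `f` that involves `x`.
    suffices ∃ g ∈ Submodule.span ℂ (pairProds (insert x S) k), link x g = link x f by
      obtain ⟨g, hg, hgf⟩ := this
      have hg' := span_pairProds_le _ _ hg
      rw [← sub_add_cancel f g]
      refine add_mem (Submodule.span_mono (pairProds_mono (subset_insert x S) k) (ih k ?_)) hg
      have h1 : f - g ∈ slice S 0 k :=
        mem_slice_of_link_eq_zero (sub_mem hf hg'.1) (by rw [map_sub, hgf, sub_self])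
      exact ⟨h1, lower_eq_zero_of_insert h1 (by rw [map_sub, h0, hg'.2, sub_self])⟩
    cases k with
    | zero =>
      refine ⟨0, zero_mem _, ?_⟩
      ext B
      have := hf (insert x B) (by simp)
      simp [link_apply, this]
    | succ k =>
      have h1 := ih k ⟨link_mem_slice hf, lower_link hx h0⟩
      have h2 : Submodule.span ℂ (pairProds S k) ≤
          (Submodule.span ℂ (pairProds (insert x S) (k + 1))).map (link x) := by
        rw [Submodule.span_le]
        intro g hg
        obtain ⟨g', hg', rfl⟩ := exists_link_eq_pairProd hx (by omega) hg
        exact ⟨g', Submodule.subset_span hg', rfl⟩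
      exact h2 h1

end PairProducts

end TwoRow

/-! ### Traces on kernels and on permutation modules -/

namespace TwoRow

open Finset Equiv

section Traces

/-- If `D` is onto and intertwines `f` and `g`, then `tr (f|ker D) = tr f - tr g`. -/
theorem trace_restrict_ker {K M N : Type*} [Field K] [AddCommGroup M] [Module K M]
    [AddCommGroup N] [Module K N] [FiniteDimensional K M] [FiniteDimensional K N]
    (D : M →ₗ[K] N) (hD : Function.Surjective D) (f : M →ₗ[K] M) (g : N →ₗ[K] N)
    (h : D ∘ₗ f = g ∘ₗ D) (hf : ∀ x ∈ LinearMap.ker D, f x ∈ LinearMap.ker D) :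
    LinearMap.trace K _ (f.restrict hf) = LinearMap.trace K M f - LinearMap.trace K N g := by
  obtain ⟨s, hs⟩ := D.exists_rightInverse_of_surjective (LinearMap.range_eq_top.2 hD)
  have hs' : ∀ y, D (s y) = y := fun y => LinearMap.congr_fun hs y
  have hDf : ∀ x, D (f x) = g (D x) := fun x => LinearMap.congr_fun h x
  -- `f ∘ (1 - s ∘ D)` has its range in `ker D` and agrees with `f` there.
  have h1 : ∀ x, (f - f ∘ₗ s ∘ₗ D) x ∈ LinearMap.ker D := fun x => by
    simp [hDf, hs']
  have h2 : f.restrict hf = (f - f ∘ₗ s ∘ₗ D).restrict (p := LinearMap.ker D)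
      (q := LinearMap.ker D) (fun x _ => h1 x) := by
    ext x
    have := x.2
    rw [LinearMap.mem_ker] at this
    simp [this]
  rw [h2, LinearMap.trace_restrict_eq_of_forall_mem _ _ h1, map_sub, ← LinearMap.comp_assoc,
    LinearMap.trace_comp_comm', ← LinearMap.comp_assoc, h, LinearMap.comp_assoc, hs,
    LinearMap.comp_id]

/-- Traces on invariant subspaces are preserved by an injective intertwining map. -/
theorem trace_restrict_map {K M N : Type*} [Field K] [AddCommGroup M] [Module K M]
    [AddCommGroup N] [Module K N] (Φ : M →ₗ[K] N) (hΦ : Function.Injective Φ)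
    (f : M →ₗ[K] M) (g : N →ₗ[K] N) (h : ∀ x, Φ (f x) = g (Φ x)) {W : Submodule K M}
    {Y : Submodule K N} (hY : Y = W.map Φ) (hf : ∀ x ∈ W, f x ∈ W) (hg : ∀ y ∈ Y, g y ∈ Y) :
    LinearMap.trace K Y (g.restrict hg) = LinearMap.trace K W (f.restrict hf) := by
  subst hY
  rw [← LinearMap.trace_conj' (f.restrict hf) (Submodule.equivMapOfInjective Φ hΦ W)]
  congr 1
  ext y
  obtain ⟨x, rfl⟩ := (Submodule.equivMapOfInjective Φ hΦ W).surjective y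
  simp [LinearEquiv.conj_apply, h]

variable {α : Type*} [DecidableEq α] [Fintype α]

/-- The action of a permutation on functions on finite sets. -/
def permAct (σ : Perm α) : (Finset α → ℂ) →ₗ[ℂ] (Finset α → ℂ) :=
  LinearMap.funLeft ℂ ℂ fun A => A.map (σ⁻¹ : Perm α).toEmbedding

theorem permAct_apply (σ : Perm α) (f : Finset α → ℂ) (A : Finset α) :
    permAct σ f A = f (A.map (σ⁻¹ : Perm α).toEmbedding) := rfl

theorem permAct_mem_slice (σ : Perm α) {d k : ℕ} {f : Finset α → ℂ}
    (hf : f ∈ slice univ d k) : permAct σ f ∈ slice univ d k := by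
  intro A hA
  refine hf _ fun h => hA ⟨subset_univ _, ?_⟩
  simpa using h.2

theorem lower_permAct (σ : Perm α) (f : Finset α → ℂ) :
    lower univ (permAct σ f) = permAct σ (lower univ f) := by
  ext B
  rw [permAct_apply, lower_apply, lower_apply]
  refine sum_equiv (σ⁻¹ : Perm α) (fun a => ?_) fun a _ => ?_
  · simp only [mem_sdiff, mem_univ, true_and]
    exact not_congr (mem_map' _).symm
  rw [permAct_apply, map_insert]
  rfl

/-- A permutation module has as its trace the number of fixed basis elements. -/
theorem trace_permAct_slice (σ : Perm α) (d k : ℕ) :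
    LinearMap.trace ℂ (slice (univ : Finset α) d k)
      ((permAct σ).restrict fun _ => permAct_mem_slice σ) =
    #{A : Finset α | A.map σ.toEmbedding = A ∧ #A + d = k} := by
  -- The projection onto the slice, followed by the action, is an operator on the whole space.
  let T : (Finset α → ℂ) →ₗ[ℂ] (Finset α → ℂ) :=
    { toFun := fun f A => if #A + d = k then permAct σ f A else 0
      map_add' := fun f g => by ext A; by_cases h : #A + d = k <;> simp [h]
      map_smul' := fun c f => by ext A; by_cases h : #A + d = k <;> simp [h] }
  have hT : ∀ f A, T f A = if #A + d = k then permAct σ f A else 0 := fun _ _ => rfl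
  have h1 : ∀ f, T f ∈ slice univ d k := fun f A hA => by
    rw [hT, if_neg fun h => hA ⟨subset_univ _, h⟩]
  have h2 : (permAct σ).restrict (fun _ => permAct_mem_slice σ) =
      T.restrict (p := slice univ d k) (q := slice univ d k) (fun f _ => h1 f) := by
    ext f A
    change permAct σ f A = T f A
    rw [hT]
    split_ifs with h
    · rfl
    · exact permAct_mem_slice σ f.2 A fun h' => h h'.2
  rw [h2, LinearMap.trace_restrict_eq_of_forall_mem _ _ h1,
    LinearMap.trace_eq_matrix_trace ℂ (Pi.basisFun ℂ (Finset α))]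
  simp only [Matrix.trace, Matrix.diag_apply, LinearMap.toMatrix_apply, Pi.basisFun_apply,
    Pi.basisFun_repr, hT, permAct_apply]
  rw [card_filter]
  push_cast
  refine sum_congr rfl fun A _ => ?_
  have : A.map (σ⁻¹ : Perm α).toEmbedding = A ↔ A.map σ.toEmbedding = A := by
    constructor <;> intro h
    · conv_lhs => rw [← h]
      rw [map_map]
      convert map_refl (s := A)
      ext; simp
    · conv_lhs => rw [← h]
      rw [map_map]
      convert map_refl (s := A)
      ext; simp
  by_cases h1 : #A + d = k <;> simp [h1, Pi.single_apply, this]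

/-- The lowering operator from the functions on `k`-subsets to those on `(k - 1)`-subsets. -/
def sliceLower (α : Type*) [DecidableEq α] [Fintype α] (k : ℕ) :
    slice (univ : Finset α) 0 k →ₗ[ℂ] slice (univ : Finset α) 1 k :=
  (lower univ).restrict fun _ => lower_mem_slice

theorem sliceLower_surjective {k : ℕ} (hk : 2 * k ≤ Fintype.card α) :
    Function.Surjective (sliceLower α k) := by
  rintro ⟨g, hg⟩
  obtain ⟨f, hf, h⟩ := exists_lower_eq (by simpa using hk) hg
  exact ⟨⟨f, hf⟩, Subtype.ext h⟩

/-- The action of a permutation on the functions on `k`-subsets. -/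
def slicePerm (σ : Perm α) (d k : ℕ) :
    slice (univ : Finset α) d k →ₗ[ℂ] slice (univ : Finset α) d k :=
  (permAct σ).restrict fun _ => permAct_mem_slice σ

theorem sliceLower_slicePerm (σ : Perm α) (k : ℕ) (f : slice (univ : Finset α) 0 k) :
    sliceLower α k (slicePerm σ 0 k f) = slicePerm σ 1 k (sliceLower α k f) :=
  Subtype.ext (lower_permAct σ f)

theorem slicePerm_mem_ker (σ : Perm α) (k : ℕ) :
    ∀ f ∈ LinearMap.ker (sliceLower α k), slicePerm σ 0 k f ∈ LinearMap.ker (sliceLower α k) := by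
  intro f hf
  rw [LinearMap.mem_ker] at hf ⊢
  rw [sliceLower_slicePerm, hf, map_zero]

theorem trace_ker_sliceLower (σ : Perm α) {k : ℕ} (hk : 2 * k ≤ Fintype.card α) :
    LinearMap.trace ℂ (LinearMap.ker (sliceLower α k))
      ((slicePerm σ 0 k).restrict (slicePerm_mem_ker σ k)) =
    #{A : Finset α | A.map σ.toEmbedding = A ∧ #A + 0 = k} -
      #{A : Finset α | A.map σ.toEmbedding = A ∧ #A + 1 = k} := by
  rw [trace_restrict_ker _ (sliceLower_surjective hk) _ (slicePerm σ 1 k)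
    (LinearMap.ext (sliceLower_slicePerm σ k)), ← trace_permAct_slice, ← trace_permAct_slice]
  rfl

end Traces

end TwoRow

/-! ### Two-row Specht modules -/

namespace TwoRow

open Finset Equiv

theorem mem_cells_twoRow {n k : ℕ} (h : 2 * k ≤ n) (c : ℕ × ℕ) :
    c ∈ (twoRow n k h).cells ↔ c.1 = 0 ∧ c.2 < n - k ∨ c.1 = 1 ∧ c.2 < k := by
  obtain ⟨i, j⟩ := c
  rw [YoungDiagram.mem_cells, twoRow, YoungDiagram.mem_ofRowLens]
  rcases i with _ | _ | i <;> simp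

theorem card_cells_twoRow {n k : ℕ} (h : 2 * k ≤ n) : #(twoRow n k h).cells = n := by
  have : (twoRow n k h).cells = {0} ×ˢ range (n - k) ∪ {1} ×ˢ range k := by
    ext ⟨i, j⟩
    rw [mem_cells_twoRow]
    simp only [mem_union, mem_product, mem_singleton, mem_range]
  rw [this, card_union_of_disjoint]
  · simp
    omega
  · rw [disjoint_left]
    rintro ⟨i, j⟩ h1 h2
    simp at h1 h2
    omega

section Tableaux

variable {n k : ℕ} {h : 2 * k ≤ n} (t : Tableau n (twoRow n k h))

/-- The entry of `t` in row `0` and column `j`, where `j` is a column of length two. -/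
def topEntry (j : Fin k) : Fin n :=
  t.symm ⟨(0, j), by rw [mem_cells_twoRow]; left; have := j.2; simp; omega⟩

/-- The entry of `t` in row `1` and column `j`. -/
def bottomEntry (j : Fin k) : Fin n :=
  t.symm ⟨(1, j), by rw [mem_cells_twoRow]; right; simp⟩

@[simp] theorem row_topEntry (j : Fin k) : t.row (topEntry t j) = 0 := by
  simp [Tableau.row, topEntry]

@[simp] theorem col_topEntry (j : Fin k) : t.col (topEntry t j) = j := by
  simp [Tableau.col, topEntry]

@[simp] theorem row_bottomEntry (j : Fin k) : t.row (bottomEntry t j) = 1 := by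
  simp [Tableau.row, bottomEntry]

@[simp] theorem col_bottomEntry (j : Fin k) : t.col (bottomEntry t j) = j := by
  simp [Tableau.col, bottomEntry]

theorem row_col (x : Fin n) : t.row x = 0 ∧ t.col x < n - k ∨ t.row x = 1 ∧ t.col x < k :=
  (mem_cells_twoRow h _).1 (t x).2

theorem eq_of_row_col {x y : Fin n} (hr : t.row x = t.row y) (hc : t.col x = t.col y) : x = y :=
  t.injective (Subtype.ext (Prod.ext hr hc))

theorem eq_topEntry_or_eq_bottomEntry {x : Fin n} {j : Fin k} (hx : t.col x = j) :
    x = topEntry t j ∨ x = bottomEntry t j := by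
  rcases row_col t x with hr | hr
  · left
    apply eq_of_row_col t <;> simp [hx, hr]
  · right
    apply eq_of_row_col t <;> simp [hx, hr]

theorem topEntry_ne_bottomEntry (i j : Fin k) : topEntry t i ≠ bottomEntry t j := fun e => by
  simpa using congrArg t.row e

theorem entries_injective : Function.Injective (Sum.elim (topEntry t) (bottomEntry t)) := by
  rw [Sum.elim_injective]
  refine ⟨fun i j e => ?_, fun i j e => ?_, topEntry_ne_bottomEntry t⟩
  · simpa [Fin.ext_iff] using congrArg t.col e
  · simpa [Fin.ext_iff] using congrArg t.col e

/-- A permutation in the column stabilizer contributes to the determinant, and no other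
permutation does. -/
theorem polytabloid_eq_det (r : Fin n → ℕ) : t.polytabloid r = Matrix.det
    (Matrix.of fun x y =>
      if t.col x = t.col y then (if r x = t.row y then (1 : ℂ) else 0) else 0) := by
  rw [Matrix.det_apply', Tableau.polytabloid, Finsupp.finsetSum_apply, Tableau.colStab, sum_filter]
  refine sum_congr rfl fun σ _ => ?_
  simp only [Matrix.of_apply, prod_ite_zero, prod_const_one]
  simp only [mem_univ, true_imp_iff]
  split_ifs with h1 h2
  · have : t.row ∘ ⇑σ⁻¹ = r := by
      ext x
      simp [← h2]
    rw [tabloidRep_single, this]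
    simp
  · have : t.row ∘ ⇑σ⁻¹ ≠ r := by
      rintro rfl
      exact h2 fun x => by simp
    rw [tabloidRep_single, Finsupp.smul_apply, Finsupp.single_eq_of_ne this.symm]
    simp
  · simp

theorem image_col : univ.image t.col = range (n - k) := by
  ext c
  simp only [mem_image, mem_univ, true_and, mem_range]
  constructor
  · rintro ⟨x, rfl⟩
    rcases row_col t x with h | h <;> omega
  · intro hc
    exact ⟨t.symm ⟨(0, c), by rw [mem_cells_twoRow]; left; simpa using hc⟩, by
      simp [Tableau.col]⟩

/-- The coefficient of a polytabloid at a tabloid, as a product over the columns. -/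
theorem polytabloid_apply (r : Fin n → ℕ) : t.polytabloid r =
    if ∀ x, k ≤ t.col x → r x = 0 then
      ∏ j, ((if r (topEntry t j) = 0 ∧ r (bottomEntry t j) = 1 then (1 : ℂ) else 0) -
        if r (topEntry t j) = 1 ∧ r (bottomEntry t j) = 0 then 1 else 0)
    else 0 := by
  rw [polytabloid_eq_det]
  set M : Matrix (Fin n) (Fin n) ℂ := Matrix.of fun x y =>
    if t.col x = t.col y then (if r x = t.row y then (1 : ℂ) else 0) else 0
  have hM' : ∀ x y, M x y =
    if t.col x = t.col y then (if r x = t.row y then (1 : ℂ) else 0) else 0 := fun _ _ => rfl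
  have hB : M.BlockTriangular t.col := fun x y hxy => by
    rw [hM', if_neg hxy.ne']
  rw [hB.det, image_col, ← prod_range_mul_prod_Ico _ (show k ≤ n - k by omega), prod_range]
  have h1 : ∀ j : Fin k, (M.toSquareBlock t.col j).det =
      ((if r (topEntry t j) = 0 ∧ r (bottomEntry t j) = 1 then (1 : ℂ) else 0) -
        if r (topEntry t j) = 1 ∧ r (bottomEntry t j) = 0 then 1 else 0) := by
    intro j
    let e : Fin 2 ≃ {x // t.col x = j} := Equiv.ofBijective
      ![⟨topEntry t j, by simp⟩, ⟨bottomEntry t j, by simp⟩] (by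
        constructor
        · intro u v
          have := topEntry_ne_bottomEntry t j j
          fin_cases u <;> fin_cases v <;> simp [this, this.symm]
        · rintro ⟨x, hx⟩
          rcases eq_topEntry_or_eq_bottomEntry t hx with rfl | rfl
          · exact ⟨0, rfl⟩
          · exact ⟨1, rfl⟩)
    have e0 : (e 0).1 = topEntry t j := rfl
    have e1 : (e 1).1 = bottomEntry t j := rfl
    rw [← Matrix.det_submatrix_equiv_self e, Matrix.det_fin_two]
    simp only [Matrix.submatrix_apply, Matrix.toSquareBlock_def, Matrix.of_apply, e0, e1, hM',
      row_topEntry, row_bottomEntry, col_topEntry, col_bottomEntry, if_true, ite_and]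
    simp only [mul_ite, mul_one, mul_zero]
    split_ifs <;> simp
  have h2 : ∏ c ∈ Ico k (n - k), (M.toSquareBlock t.col c).det =
      if ∀ x, k ≤ t.col x → r x = 0 then 1 else 0 := by
    have h3 : ∀ c ∈ Ico k (n - k), (M.toSquareBlock t.col c).det =
        if ∀ x, t.col x = c → r x = 0 then 1 else 0 := by
      intro c hc
      rw [mem_Ico] at hc
      obtain ⟨x, hx⟩ : ∃ x, t.col x = c := by
        have : c ∈ univ.image t.col := by rw [image_col, mem_range]; exact hc.2
        simpa using this
      have hrow : ∀ y, t.col y = c → t.row y = 0 := fun y hy => by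
        rcases row_col t y with h | h <;> omega
      have huniq : ∀ y, t.col y = c → y = x := fun y hy =>
        eq_of_row_col t (by rw [hrow y hy, hrow x hx]) (by rw [hy, hx])
      let u : Unique {y // t.col y = c} := ⟨⟨⟨x, hx⟩⟩, fun y => Subtype.ext (huniq y y.2)⟩
      rw [Matrix.det_unique]
      have hd : (default : {y // t.col y = c}).1 = x := rfl
      simp only [Matrix.toSquareBlock_def, Matrix.of_apply, hd, hM', if_true, hrow x hx]
      refine if_congr ⟨fun h y hy => ?_, fun h => h x hx⟩ rfl rfl
      rwa [huniq y hy]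
    rw [prod_congr rfl h3, prod_ite_zero, prod_const_one]
    refine if_congr ⟨fun h x hx => h _ ?_ x rfl, fun h c hc x hx => h x ?_⟩ rfl rfl
    · rw [mem_Ico]
      rcases row_col t x with h | h <;> omega
    · rw [hx]
      exact (mem_Ico.1 hc).1
  rw [h2, prod_congr rfl fun j _ => h1 j]
  split_ifs <;> simp

end Tableaux

section Embedding

variable {n k : ℕ}

/-- The tabloid with two rows whose second row is `A`. -/
def tabloid (A : Finset (Fin n)) (x : Fin n) : ℕ := if x ∈ A then 1 else 0

theorem tabloid_injective : Function.Injective (tabloid (n := n)) := by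
  intro A B h
  ext x
  have := congrFun h x
  by_cases hA : x ∈ A <;> by_cases hB : x ∈ B <;> simp_all [tabloid]

/-- Functions on the subsets of `Fin n` as combinations of tabloids with at most two rows. -/
noncomputable def toTabloid (n : ℕ) : (Finset (Fin n) → ℂ) →ₗ[ℂ] ((Fin n → ℕ) →₀ ℂ) :=
  Finsupp.lmapDomain ℂ ℂ tabloid ∘ₗ
    (Finsupp.linearEquivFunOnFinite ℂ ℂ (Finset (Fin n))).symm.toLinearMap

theorem toTabloid_tabloid (f : Finset (Fin n) → ℂ) (A : Finset (Fin n)) :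
    toTabloid n f (tabloid A) = f A := by
  rw [toTabloid, LinearMap.comp_apply, Finsupp.lmapDomain_apply,
    Finsupp.mapDomain_apply tabloid_injective]
  rfl

theorem toTabloid_of_notMem_range (f : Finset (Fin n) → ℂ) {r : Fin n → ℕ}
    (hr : r ∉ Set.range (tabloid (n := n))) : toTabloid n f r = 0 := by
  rw [toTabloid, LinearMap.comp_apply, Finsupp.lmapDomain_apply,
    Finsupp.mapDomain_of_notMem_range _ _ hr]

theorem toTabloid_injective : Function.Injective (toTabloid n) := by
  intro f g h
  ext A
  rw [← toTabloid_tabloid f, h, toTabloid_tabloid]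

theorem tabloidRep_apply (σ : Perm (Fin n)) (w : (Fin n → ℕ) →₀ ℂ) (r : Fin n → ℕ) :
    tabloidRep n σ w r = w (r ∘ ⇑σ) := by
  have hi : Function.Injective fun r : Fin n → ℕ => r ∘ ⇑σ⁻¹ := fun r s h => by
    ext x
    simpa using congrFun h (σ x)
  have hr : r = (fun r : Fin n → ℕ => r ∘ ⇑σ⁻¹) (r ∘ ⇑σ) := by
    ext x
    simp
  conv_lhs => rw [hr]
  exact Finsupp.mapDomain_apply hi w _

theorem toTabloid_permAct (σ : Perm (Fin n)) (f : Finset (Fin n) → ℂ) :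
    toTabloid n (permAct σ f) = tabloidRep n σ (toTabloid n f) := by
  ext r
  rw [tabloidRep_apply]
  by_cases hr : r ∈ Set.range (tabloid (n := n))
  · obtain ⟨A, rfl⟩ := hr
    have : tabloid A ∘ ⇑σ = tabloid (A.map (σ⁻¹ : Perm (Fin n)).toEmbedding) := by
      ext x
      have : x ∈ A.map (σ⁻¹ : Perm (Fin n)).toEmbedding ↔ σ x ∈ A := by
        rw [mem_map_equiv]
        rfl
      simp only [tabloid, Function.comp_apply, this]
    rw [this, toTabloid_tabloid, toTabloid_tabloid, permAct_apply]
  · rw [toTabloid_of_notMem_range _ hr, toTabloid_of_notMem_range]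
    rintro ⟨A, hA⟩
    refine hr ⟨A.map σ.toEmbedding, ?_⟩
    ext x
    have h1 := congrFun hA (σ.symm x)
    have : x ∈ A.map σ.toEmbedding ↔ σ.symm x ∈ A := mem_map_equiv
    simpa [tabloid, this] using h1

/-- A two-row polytabloid is a product of disjoint differences, one for each column of length
two. -/
theorem polytabloid_eq_toTabloid {h : 2 * k ≤ n} (t : Tableau n (twoRow n k h)) :
    t.polytabloid = toTabloid n (pairProd (topEntry t) (bottomEntry t)) := by
  ext r
  rw [polytabloid_apply]
  by_cases hr : r ∈ Set.range (tabloid (n := n))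
  · obtain ⟨A, rfl⟩ := hr
    have hs : ∀ j, ((if tabloid A (topEntry t j) = 0 ∧ tabloid A (bottomEntry t j) = 1
        then (1 : ℂ) else 0) - if tabloid A (topEntry t j) = 1 ∧ tabloid A (bottomEntry t j) = 0
        then 1 else 0) = pairSign A (topEntry t j) (bottomEntry t j) := by
      intro j
      by_cases ha : topEntry t j ∈ A <;> by_cases hb : bottomEntry t j ∈ A <;>
        simp [tabloid, pairSign, ha, hb]
    simp only [hs]
    rw [toTabloid_tabloid, pairProd]
    by_cases h0 : ∏ j, pairSign A (topEntry t j) (bottomEntry t j) = 0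
    · simp [h0]
    refine if_congr ⟨fun hA => ?_, fun hA x hx => ?_⟩ rfl rfl
    · refine le_antisymm ?_ (le_card_of_pairs (entries_injective t) (meets_of_prod_ne_zero h0))
      have hcol : ∀ x ∈ A, t.col x < k := fun x hx => by
        by_contra! hk
        simpa [tabloid, hx] using hA x hk
      rw [← card_range k]
      refine card_le_card_of_injOn t.col (fun x hx => by simpa using hcol x hx) ?_
      intro x hx y hy hxy
      rw [prod_eq_zero_iff] at h0
      by_contra hne
      refine h0 ⟨⟨t.col x, hcol x hx⟩, mem_univ _, ?_⟩
      rw [mem_coe] at hx hy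
      rcases eq_topEntry_or_eq_bottomEntry t (x := x) (j := ⟨t.col x, hcol x hx⟩) rfl
        with h1 | h1 <;>
      rcases eq_topEntry_or_eq_bottomEntry t (x := y) (j := ⟨t.col x, hcol x hx⟩) hxy.symm
        with h2 | h2
      · exact absurd (h1.trans h2.symm) hne
      · rw [pairSign, ← h1, ← h2, if_pos hx, if_pos hy, sub_self]
      · rw [pairSign, ← h1, ← h2, if_pos hx, if_pos hy, sub_self]
      · exact absurd (h1.trans h2.symm) hne
    · by_contra hxA
      refine h0 (prod_eq_zero_of_extra (entries_injective t) hA (c := x) ?_ ?_)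
      · by_contra hx'
        exact hxA (by simp [tabloid, hx'])
      · rintro (j | j) rfl
        · exact absurd hx (by simp)
        · exact absurd hx (by simp)
  · rw [toTabloid_of_notMem_range _ hr, ite_eq_right_iff]
    intro hcol
    obtain ⟨x, hx⟩ : ∃ x, r x ≠ 0 ∧ r x ≠ 1 := by
      by_contra! h0
      refine hr ⟨univ.filter fun x => r x = 1, ?_⟩
      ext x
      by_cases hx : r x = 0
      · simp [tabloid, hx]
      · simp [tabloid, h0 x hx]
    have hxk : t.col x < k := by
      by_contra! hk
      exact hx.1 (hcol x hk)
    refine prod_eq_zero (mem_univ ⟨t.col x, hxk⟩) ?_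
    rcases eq_topEntry_or_eq_bottomEntry t (x := x) (j := ⟨t.col x, hxk⟩) rfl with h1 | h1 <;>
      rw [← h1] <;> simp [hx]

/-- Any `2k` distinct entries can be placed into the columns of length two. -/
theorem exists_tableau (h : 2 * k ≤ n) {a b : Fin k → Fin n}
    (hab : Function.Injective (Sum.elim a b)) :
    ∃ t : Tableau n (twoRow n k h), topEntry t = a ∧ bottomEntry t = b := by
  let cell : Fin k ⊕ Fin k → ℕ × ℕ := Sum.elim (fun j => (0, j)) fun j => (1, j)
  have hcell : Function.Injective cell := by
    rw [Sum.elim_injective]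
    refine ⟨fun i j e => ?_, fun i j e => ?_, fun i j e => ?_⟩
    · simpa [Fin.ext_iff] using e
    · simpa [Fin.ext_iff] using e
    · simp at e
  have hmem : ∀ y, cell y ∈ (twoRow n k h).cells := by
    rintro (j | j) <;> rw [mem_cells_twoRow]
    · have := j.2
      left
      simp [cell]
      omega
    · right
      simp [cell]
  let f : Fin n → ℕ × ℕ := Function.extend (Sum.elim a b) cell fun _ => 0
  have hf : ∀ y, f (Sum.elim a b y) = cell y := fun y => hab.extend_apply _ _ y
  obtain ⟨t, ht⟩ := Set.MapsTo.exists_equiv_extend_of_card_eq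
    (t := (twoRow n k h).cells) (s := Set.range (Sum.elim a b)) (f := f)
    (by rw [card_cells_twoRow, Fintype.card_fin])
    (by rintro _ ⟨y, rfl⟩; rw [hf]; exact hmem y)
    (by
      rintro _ ⟨y, rfl⟩ _ ⟨z, rfl⟩ hyz
      rw [hf, hf] at hyz
      rw [hcell hyz])
  refine ⟨t, ?_, ?_⟩
  · ext1 j
    rw [topEntry, Equiv.symm_apply_eq]
    exact Subtype.ext ((ht _ ⟨.inl j, rfl⟩).trans (hf (.inl j))).symm
  · ext1 j
    rw [bottomEntry, Equiv.symm_apply_eq]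
    exact Subtype.ext ((ht _ ⟨.inr j, rfl⟩).trans (hf (.inr j))).symm

/-- The two-row Specht module is the kernel of the lowering operator on `k`-subsets. -/
theorem specht_twoRow (h : 2 * k ≤ n) : (specht n (twoRow n k h)).toSubmodule =
    (LinearMap.ker (sliceLower (Fin n) k)).map (toTabloid n ∘ₗ Submodule.subtype _) := by
  have h1 : (LinearMap.ker (sliceLower (Fin n) k)).map (Submodule.subtype _) =
      slice univ 0 k ⊓ LinearMap.ker (lower univ) := by
    ext f
    constructor
    · rintro ⟨f, hf, rfl⟩
      exact ⟨f.2, congrArg Subtype.val hf⟩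
    · rintro ⟨hf, h0⟩
      exact ⟨⟨f, hf⟩, Subtype.ext h0, rfl⟩
  rw [Submodule.map_comp, h1, slice_inf_ker_lower, Submodule.map_span]
  change Submodule.span ℂ _ = _
  congr 1
  ext w
  constructor
  · rintro ⟨t, rfl⟩
    exact ⟨_, ⟨_, _, entries_injective t, fun _ => mem_univ _, rfl⟩,
      (polytabloid_eq_toTabloid t).symm⟩
  · rintro ⟨_, ⟨a, b, hab, -, rfl⟩, rfl⟩
    obtain ⟨t, rfl, rfl⟩ := exists_tableau h hab
    exact ⟨t, polytabloid_eq_toTabloid t⟩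

/-- The character of a two-row Specht module counts fixed `k`-subsets minus fixed
`(k - 1)`-subsets. -/
theorem chi_twoRow (h : 2 * k ≤ n) (σ : Perm (Fin n)) : chi n (twoRow n k h) σ =
    #{A : Finset (Fin n) | A.map σ.toEmbedding = A ∧ #A + 0 = k} -
      #{A : Finset (Fin n) | A.map σ.toEmbedding = A ∧ #A + 1 = k} := by
  rw [← trace_ker_sliceLower σ (by simpa using h)]
  have hΦ : Function.Injective
      (toTabloid n ∘ₗ (slice (univ : Finset (Fin n)) 0 k).subtype) :=
    toTabloid_injective.comp Subtype.val_injective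
  have hΦσ : ∀ f, (toTabloid n ∘ₗ (slice univ 0 k).subtype) (slicePerm σ 0 k f) =
      tabloidRep n σ ((toTabloid n ∘ₗ (slice univ 0 k).subtype) f) := fun f =>
    toTabloid_permAct σ f.1
  exact trace_restrict_map _ hΦ (slicePerm σ 0 k) (tabloidRep n σ) hΦσ (specht_twoRow h)
    (slicePerm_mem_ker σ k) ((specht n (twoRow n k h)).apply_mem_toSubmodule σ)

end Embedding

end TwoRow

/-! ### Subsets fixed by an involution, and the polynomials `p_{n,i}` -/

namespace TwoRow

open Finset Equiv

section FixedSets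

open Polynomial

variable {α β : Type*} [DecidableEq α] [Fintype α] [DecidableEq β] [Fintype β]

/-- The generating polynomial, by cardinality, of the sets fixed by a permutation. -/
noncomputable def fixedPoly (σ : Perm α) : ℤ[X] :=
  ∑ A : Finset α, if A.map σ.toEmbedding = A then X ^ #A else 0

theorem coeff_fixedPoly (σ : Perm α) (k : ℕ) :
    (fixedPoly σ).coeff k = #{A : Finset α | A.map σ.toEmbedding = A ∧ #A = k} := by
  rw [fixedPoly, finsetSum_coeff, card_filter]
  push_cast
  refine sum_congr rfl fun A _ => ?_
  by_cases h : A.map σ.toEmbedding = A <;> simp [h, coeff_X_pow, eq_comm]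

theorem fixedPoly_permCongr (e : α ≃ β) (σ : Perm α) :
    fixedPoly (e.permCongr σ) = fixedPoly σ := by
  symm
  refine sum_equiv e.finsetCongr (fun A => by simp) fun A _ => ?_
  have : (A.map e.toEmbedding).map (e.permCongr σ).toEmbedding =
      (A.map σ.toEmbedding).map e.toEmbedding := by
    rw [map_map, map_map]
    congr 1
    ext x
    simp
  simp only [finsetCongr_apply, this, card_map, (map_injective e.toEmbedding).eq_iff]

/-- The involution that fixes `α` and swaps two copies of `β`. -/
def swapCopies (α β : Type*) : Perm (α ⊕ (β ⊕ β)) :=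
  Equiv.sumCongr (Equiv.refl α) (Equiv.sumComm β β)

theorem one_add_pow_card (γ : Type*) [Fintype γ] (q : ℤ[X]) :
    (1 + q) ^ Fintype.card γ = ∑ B : Finset γ, q ^ #B := by
  rw [add_comm, ← Fintype.sum_pow_mul_eq_add_pow]
  simp

/-- A set fixed by `swapCopies α β` consists of a subset of `α` and two copies of one subset
of `β`. -/
theorem fixedPoly_swapCopies :
    fixedPoly (swapCopies α β) =
      (1 + X) ^ Fintype.card α * (1 + X ^ 2) ^ Fintype.card β := by
  have h1 : ∀ (B : Finset α) (C C' : Finset β),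
      (B.disjSum (C.disjSum C')).map (swapCopies α β).toEmbedding =
        B.disjSum (C'.disjSum C) := by
    intro B C C'
    ext x
    rw [mem_map_equiv]
    rcases x with x | x | x <;> simp [swapCopies]
  have h3 : fixedPoly (swapCopies α β) = ∑ y : Finset α × (Finset β × Finset β),
      if y.2.1 = y.2.2 then (X : ℤ[X]) ^ (#y.1 + (#y.2.1 + #y.2.2)) else 0 := by
    symm
    refine Fintype.sum_equiv ((Equiv.prodCongr (Equiv.refl _) sumEquiv.symm.toEquiv).trans
      sumEquiv.symm.toEquiv) _ _ ?_
    rintro ⟨B, C, C'⟩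
    change _ = if (B.disjSum (C.disjSum C')).map _ = B.disjSum (C.disjSum C') then
      X ^ #(B.disjSum (C.disjSum C')) else 0
    rw [h1, card_disjSum, card_disjSum]
    refine if_congr ?_ rfl rfl
    constructor
    · rintro h
      simp only at h
      rw [h]
    · intro h
      ext x
      simpa using Finset.ext_iff.1 h (.inr (.inr x))
  rw [h3, one_add_pow_card, one_add_pow_card, sum_mul_sum, Fintype.sum_prod_type]
  refine sum_congr rfl fun B _ => ?_
  rw [Fintype.sum_prod_type]
  refine sum_congr rfl fun C _ => ?_
  rw [sum_ite_eq, if_pos (mem_univ _)]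
  ring

theorem cycleType_permCongr_swapCopies {γ : Type*} [DecidableEq γ] [Fintype γ]
    (e : α ⊕ (β ⊕ β) ≃ γ) :
    (e.permCongr (swapCopies α β)).cycleType = Multiset.replicate (Fintype.card β) 2 := by
  set σ := e.permCongr (swapCopies α β) with hσ
  have h1 : σ ^ 2 = 1 := by
    ext x
    obtain ⟨y, rfl⟩ := e.surjective x
    rw [sq, hσ]
    rcases y with y | y | y <;> simp [swapCopies]
  have h2 := Perm.cycleType_of_pow_prime_eq_one h1
  have h3 : σ.support = (univ.map ⟨Sum.inr, Sum.inr_injective⟩).map e.toEmbedding := by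
    ext x
    obtain ⟨y, rfl⟩ := e.surjective x
    rw [Perm.mem_support, hσ]
    rcases y with y | y | y <;> simp [swapCopies]
  have h4 := σ.sum_cycleType
  rw [h3, h2, card_map, card_map, Multiset.sum_replicate] at h4
  simp at h4
  rw [h2]
  congr 1
  omega

end FixedSets

section Characters

open Polynomial

/-- The generating polynomial of the fixed sets of a permutation of cycle type `2^j 1^{n-2j}`:
a fixed set is a union of orbits. -/
noncomputable def invPoly (n j : ℕ) : ℤ[X] := (1 + X) ^ (n - 2 * j) * (1 + X ^ 2) ^ j

/-- The coefficient of a polynomial at an integer, zero at the negative ones. -/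
noncomputable def intCoeff (k : ℤ) : ℤ[X] →ₗ[ℤ] ℤ := if 0 ≤ k then lcoeff ℤ k.toNat else 0

theorem intCoeff_natCast (k : ℕ) (f : ℤ[X]) : intCoeff k f = f.coeff k := by
  simp [intCoeff]

theorem intCoeff_of_neg {k : ℤ} (hk : k < 0) (f : ℤ[X]) : intCoeff k f = 0 := by
  simp [intCoeff, hk.not_ge]

theorem p_eq_intCoeff (n i : ℕ) (k : ℤ) : p n i k = intCoeff k (pPoly n i) := by
  unfold p intCoeff
  split_ifs <;> simp

theorem intCoeff_X_mul (k : ℤ) (f : ℤ[X]) : intCoeff k (X * f) = intCoeff (k - 1) f := by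
  rcases lt_or_ge k 0 with hk | hk
  · rw [intCoeff_of_neg hk, intCoeff_of_neg (by omega)]
  lift k to ℕ using hk
  cases k with
  | zero => rw [intCoeff_natCast, coeff_X_mul_zero, intCoeff_of_neg (by simp)]
  | succ k =>
    rw [intCoeff_natCast, coeff_X_mul, ← intCoeff_natCast]
    congr 2
    push_cast
    ring

theorem chiAt_twoRow {n k j : ℕ} (h : 2 * k ≤ n) (hj : 2 * j ≤ n) :
    chiAt n (twoRow n k h) j =
      ((intCoeff k (invPoly n j) - intCoeff (k - 1) (invPoly n j) : ℤ) : ℂ) := by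
  let e : Fin (n - 2 * j) ⊕ (Fin j ⊕ Fin j) ≃ Fin n := Fintype.equivFinOfCardEq (by
    simp
    omega)
  have hf : fixedPoly (e.permCongr (swapCopies (Fin (n - 2 * j)) (Fin j))) = invPoly n j := by
    rw [fixedPoly_permCongr, fixedPoly_swapCopies, invPoly, Fintype.card_fin, Fintype.card_fin]
  rw [chiAt_eq _ hj (e.permCongr (swapCopies (Fin (n - 2 * j)) (Fin j)))
    (by rw [cycleType_permCongr_swapCopies, Fintype.card_fin]), chi_twoRow, ← hf,
    intCoeff_natCast, coeff_fixedPoly]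
  push_cast
  congr 1
  cases k with
  | zero => simp [intCoeff_of_neg]
  | succ k =>
    have : ((k + 1 : ℕ) : ℤ) - 1 = (k : ℕ) := by push_cast; ring
    rw [this, intCoeff_natCast, coeff_fixedPoly]
    simp

/-- The binomial theorem for `(1 + x)² + (1 + x²) = 2 (1 + x + x²)`. -/
theorem sum_choose_mul_invPoly {n i : ℕ} (hi : 2 * i ≤ n) :
    ∑ j ∈ range (i + 1), (i.choose j : ℤ) • invPoly n j = (2 ^ i : ℤ) • pPoly n i := by
  have h1 : (2 ^ i : ℤ) • pPoly n i =
      (1 + X) ^ (n - 2 * i) * ((1 + X ^ 2) + (1 + X) ^ 2) ^ i := by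
    have : ((1 + X ^ 2) + (1 + X) ^ 2 : ℤ[X]) = 2 * (1 + X + X ^ 2) := by ring
    rw [this, mul_pow, pPoly, zsmul_eq_mul]
    push_cast
    ring
  rw [h1, add_pow (1 + X ^ 2 : ℤ[X]), mul_sum]
  refine sum_congr rfl fun j hj => ?_
  rw [mem_range] at hj
  have h2 : n - 2 * j = (n - 2 * i) + 2 * (i - j) := by omega
  rw [invPoly, h2, pow_add, pow_mul, zsmul_eq_mul]
  push_cast
  ring

theorem pPoly_recurrence {n i : ℕ} (hi : 1 ≤ i) :
    pPoly n i = pPoly (n - 2) (i - 1) + X * pPoly (n - 2) (i - 1) +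
      X * (X * pPoly (n - 2) (i - 1)) := by
  obtain ⟨i, rfl⟩ := Nat.exists_eq_add_of_le' hi
  have : n - 2 * (i + 1) = n - 2 - 2 * i := by omega
  rw [pPoly, pPoly, this, Nat.add_sub_cancel, pow_succ]
  ring

theorem alpha_eq {n k i : ℕ} (hk : 2 * k ≤ n) (hi : 2 * i ≤ n) :
    alpha n k i = ((p n i k - p n i (k - 1) : ℤ) : ℂ) := by
  rw [alpha, dif_pos ⟨hk, hi⟩, alphaShape, div_eq_iff (pow_ne_zero _ two_ne_zero), p_eq_intCoeff,
    p_eq_intCoeff]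
  have h1 : ∀ m, ∑ j ∈ range (i + 1), (i.choose j : ℤ) * intCoeff m (invPoly n j) =
      2 ^ i * intCoeff m (pPoly n i) := fun m => by
    have := congrArg (intCoeff m) (sum_choose_mul_invPoly hi)
    simpa only [map_sum, map_smul, smul_eq_mul] using this
  have h2 : ∑ j ∈ range (i + 1), (i.choose j : ℂ) * chiAt n (twoRow n k hk) j =
      ((∑ j ∈ range (i + 1), (i.choose j : ℤ) *
        (intCoeff k (invPoly n j) - intCoeff (k - 1) (invPoly n j)) : ℤ) : ℂ) := by
    push_cast
    refine sum_congr rfl fun j hj => ?_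
    rw [mem_range] at hj
    rw [chiAt_twoRow hk (by omega)]
    push_cast
    rfl
  rw [h2]
  simp only [mul_sub, sum_sub_distrib, h1]
  push_cast
  ring

end Characters

end TwoRow

theorem mainTheorem5 (l s i : ℕ) (hs : s = 0 ∨ s = 1) (hi : 1 ≤ i) (hil : i ≤ l) :
    (∀ k : ℤ, TwoRow.p (2 * l + s) i k =
      TwoRow.p (2 * l + s - 2) (i - 1) k + TwoRow.p (2 * l + s - 2) (i - 1) (k - 1) +
        TwoRow.p (2 * l + s - 2) (i - 1) (k - 2)) ∧
    (∀ k : ℕ, k ≤ l → TwoRow.alpha (2 * l + s) k i =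
      ((TwoRow.p (2 * l + s) i (k : ℤ) - TwoRow.p (2 * l + s) i ((k : ℤ) - 1) : ℤ) : ℂ)) := by
  refine ⟨fun k => ?_, fun k hk => TwoRow.alpha_eq (by omega) (by omega)⟩
  simp only [TwoRow.p_eq_intCoeff]
  rw [TwoRow.pPoly_recurrence hi, map_add, map_add, TwoRow.intCoeff_X_mul,
    TwoRow.intCoeff_X_mul, TwoRow.intCoeff_X_mul, sub_sub, one_add_one_eq_two]
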